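/- Let $X$ be a countably infinite set and let $(b,c)$ be a graph over $X$: $b\colon X\times X\to[0,\infty)$ is symmetric, vanishes on the diagonal and satisfies $\sum_{y}b(x,y)<\infty$ for all $x\in X$, and $c\colon X\to[0,\infty)$. For $f\colon X\to\mathbb{C}$ put $$\tilde Q(f)=\frac12\sum_{x,y\in X}b(x,y)|f(x)-f(y)|^2+\sum_{x\in X}c(x)|f(x)|^2\in[0,\infty].$$ Let $\tilde D=\{f:\tilde Q(f)<\infty\}$ and let $\tilde D_0$ be the closure of the finitely supported functions in $\tilde D$ with respect to the norm $(\tilde Q(f)+|f(o)|^2)^{1/2}$, $o\in X$. Assume that $(b,c)$ is connected (any two vertices are joined by a finite chain of vertices along which $b>0$), so that $\tilde D_0$ does not depend on $o$, and that $(b,c)$ is uniformly transient with constant $C>0$, i.e. $$\|f\|_\infty^2\le C\,\tilde Q(f)\qquad\text{for all } f\in\tilde D_0 .$$ Let $m\colon X\to(0,\infty)$, extended to a measure on $X$ by additivity, satisfy $m(X)<\infty$. Let $Q^{(D)}$ be the closure in the complex Hilbert space $\ell^2(X,m)$ of the restriction of $\tilde Q$ to the finitely supported functions, and let $L^{(D)}$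 be its generator, i.e. the operator with $L^{(D)}f=g$ if and only if $f\in D(Q^{(D)})$, $g\in\ell^2(X,m)$ and $Q^{(D)}(h,f)=\langle h,g\rangle$ for all $h\in D(Q^{(D)})$ (forms and inner products being linear in the second argument). Then the spectrum of $L^{(D)}$ is purely discrete, that is, it consists of isolated eigenvalues of finite multiplicity. Moreover the eigenvalues of $L^{(D)}$, counted with multiplicity, can be listed in nondecreasing order as $\lambda_1\le\lambda_2\le\cdots$, and $$\lambda_k\ge\frac{k}{C\,m(X)}\qquad\text{for all } k\ge1 .$$ -/

import Mathlib

open MeasureTheory Filter Topology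
open scoped ENNReal NNReal ComplexConjugate

noncomputable section

/-! ### Unbounded operators: spectrum, eigenvalues, generators of forms -/

namespace UnboundedOp

variable {H : Type*} [NormedAddCommGroup H] [InnerProductSpace ℂ H]

/-- `z` is in the resolvent set of `T` iff `T - z : D(T) → H` is bijective with a bounded
everywhere defined inverse `R`. -/
def resolventSet (T : H →ₗ.[ℂ] H) : Set ℂ :=
  {z | ∃ R : H →L[ℂ] H,
    (∀ u : H, ∃ h : R u ∈ T.domain, T ⟨R u, h⟩ - z • R u = u) ∧
    ∀ u : T.domain, R (T u - z • (u : H)) = u}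

/-- The spectrum of an unbounded operator. -/
def spectrum (T : H →ₗ.[ℂ] H) : Set ℂ := (resolventSet T)ᶜ

/-- The eigenspace `{u ∈ D(T) | T u = z u}`. -/
def eigenspace (T : H →ₗ.[ℂ] H) (z : ℂ) : Submodule ℂ H :=
  (LinearMap.ker (T.toFun - z • T.domain.subtype)).map T.domain.subtype

/-- The spectrum is purely discrete: it consists of isolated points, each of which is an
eigenvalue of finite multiplicity. -/
def HasPurelyDiscreteSpectrum (T : H →ₗ.[ℂ] H) : Prop :=
  ∀ z ∈ spectrum T, (∀ᶠ w in 𝓝[≠] z, w ∉ spectrum T) ∧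
    eigenspace T z ≠ ⊥ ∧ FiniteDimensional ℂ (eigenspace T z)

/-- `ev 0 ≤ ev 1 ≤ …` is the list of all eigenvalues of `T` in nondecreasing order, each `z`
occurring exactly as often as its multiplicity `dim ker (T - z)` says. -/
def IsEigenvalueSequence (T : H →ₗ.[ℂ] H) (ev : ℕ → ℝ) : Prop :=
  Monotone ev ∧
    ∀ z : ℂ, {k : ℕ | (ev k : ℂ) = z}.encard = Cardinal.toENat (Module.rank ℂ (eigenspace T z))

/-- The graph of the operator associated with a form `q` on `D`: pairs `(f, g)` with `f ∈ D` and
`q(h, f) = ⟪h, g⟫` for all `h ∈ D`. -/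
def formGraph (D : Submodule ℂ H) (q : D →ₗ⋆[ℂ] D →ₗ[ℂ] ℂ) : Submodule ℂ (H × H) where
  carrier := {p | ∃ hp : p.1 ∈ D, ∀ h : D, q h ⟨p.1, hp⟩ = inner ℂ (h : H) p.2}
  zero_mem' := ⟨D.zero_mem, fun h => by
    have : (⟨(0 : H × H).1, D.zero_mem⟩ : D) = 0 := rfl
    rw [this]; simp⟩
  add_mem' := by
    rintro p r ⟨hp, h1⟩ ⟨hr, h2⟩
    refine ⟨D.add_mem hp hr, fun h => ?_⟩
    have : (⟨(p + r).1, D.add_mem hp hr⟩ : D) = ⟨p.1, hp⟩ + ⟨r.1, hr⟩ := rfl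
    rw [this, map_add, h1, h2, Prod.snd_add, inner_add_right]
  smul_mem' := by
    rintro a p ⟨hp, h1⟩
    refine ⟨D.smul_mem a hp, fun h => ?_⟩
    have : (⟨(a • p).1, D.smul_mem a hp⟩ : D) = a • ⟨p.1, hp⟩ := rfl
    rw [this, map_smul, h1, Prod.smul_snd, inner_smul_right, smul_eq_mul]

/-- The generator `L` of a densely defined form `q` on `D`:
`D(L) = {f ∈ D | ∃ g, ∀ h ∈ D, q(h, f) = ⟪h, g⟫}` and `L f = g`. -/
def formGenerator (D : Submodule ℂ H) (q : D →ₗ⋆[ℂ] D →ₗ[ℂ] ℂ) : H →ₗ.[ℂ] H :=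
  (formGraph D q).toLinearPMap

/-- If `D` is dense, then `g` is determined by `f`, so the generator has the expected graph. -/
theorem graph_formGenerator {D : Submodule ℂ H} (hD : Dense (D : Set H))
    (q : D →ₗ⋆[ℂ] D →ₗ[ℂ] ℂ) : (formGenerator D q).graph = formGraph D q := by
  apply Submodule.toLinearPMap_graph_eq
  rintro ⟨f, g⟩ ⟨hf, h1⟩ h0
  simp only at h0 hf h1 ⊢
  subst h0
  refine hD.eq_zero_of_inner_right (𝕜 := ℂ) fun v hv => ?_
  have h2 := h1 ⟨v, hv⟩
  have : (⟨(0 : H), hf⟩ : D) = 0 := rfl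
  rw [this, map_zero] at h2
  exact h2.symm

end UnboundedOp

/-! ### Discrete measure spaces -/

/-- A function `m : X → (0, ∞)`. -/
structure VertexMeasure (X : Type*) where
  weight : X → ℝ≥0
  pos : ∀ x, 0 < weight x

namespace VertexMeasure

variable {X : Type*} [MeasurableSpace X]

/-- The measure `m(A) = ∑_{x ∈ A} m(x)`. -/
def toMeasure (m : VertexMeasure X) : Measure X :=
  Measure.sum fun x => (m.weight x : ℝ≥0∞) • Measure.dirac x

/-- The complex Hilbert space `ℓ²(X, m)`. -/
abbrev l2 (m : VertexMeasure X) : Type _ := Lp ℂ 2 m.toMeasure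

theorem toMeasure_singleton [DiscreteMeasurableSpace X] (m : VertexMeasure X) (x : X) :
    m.toMeasure {x} = m.weight x := by
  classical
  rw [toMeasure, Measure.sum_apply _ (measurableSet_singleton x), tsum_eq_single x]
  · simp
  · intro y hy
    simp [hy]

theorem eq_of_ae_eq [DiscreteMeasurableSpace X] (m : VertexMeasure X) {f g : X → ℂ}
    (h : f =ᵐ[m.toMeasure] g) : f = g := by
  funext x
  by_contra hx
  have h0 : m.toMeasure {x} = 0 :=
    measure_mono_null (Set.singleton_subset_iff.2 hx) (ae_iff.1 h)
  rw [toMeasure_singleton] at h0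
  exact (m.pos x).ne' (by exact_mod_cast h0)

theorem coe_add [DiscreteMeasurableSpace X] (m : VertexMeasure X) (f g : m.l2) :
    ((f + g : m.l2) : X → ℂ) = (f : X → ℂ) + (g : X → ℂ) := m.eq_of_ae_eq (Lp.coeFn_add f g)

theorem coe_smul [DiscreteMeasurableSpace X] (m : VertexMeasure X) (a : ℂ) (f : m.l2) :
    ((a • f : m.l2) : X → ℂ) = a • (f : X → ℂ) := m.eq_of_ae_eq (Lp.coeFn_smul a f)

theorem coe_zero [DiscreteMeasurableSpace X] (m : VertexMeasure X) :
    ((0 : m.l2) : X → ℂ) = 0 := m.eq_of_ae_eq (Lp.coeFn_zero ℂ 2 m.toMeasure)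

end VertexMeasure

/-! ### Graphs and their energy forms -/

/-- A graph `(b, c)` over `X`. -/
structure WeightedGraph (X : Type*) where
  b : X → X → ℝ≥0
  c : X → ℝ≥0
  b_symm : ∀ x y, b x y = b y x
  b_diag : ∀ x, b x x = 0
  b_summable : ∀ x, Summable (b x)

namespace WeightedGraph

variable {X : Type*} (G : WeightedGraph X)

/-- The combinatorial graph: `x ∼ y` iff `b(x, y) > 0`. -/
def toSimpleGraph : SimpleGraph X where
  Adj x y := 0 < G.b x y
  symm := ⟨fun x y h => by rw [G.b_symm]; exact h⟩
  loopless := ⟨fun x h => by simp [G.b_diag] at h⟩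

/-- The energy form
`Q̃(f) = ½ ∑_{x,y} b(x,y) |f(x) - f(y)|² + ∑_x c(x) |f(x)|² ∈ [0, ∞]`. -/
def energy (f : X → ℂ) : ℝ≥0∞ :=
  2⁻¹ * ∑' p : X × X, (G.b p.1 p.2 : ℝ≥0∞) * ‖f p.1 - f p.2‖ₑ ^ 2 +
    ∑' x, (G.c x : ℝ≥0∞) * ‖f x‖ₑ ^ 2

/-- `D̃₀`: the closure of the finitely supported functions in the space `D̃` of functions of
finite energy, with respect to the norm `(Q̃(f) + |f(o)|²)^{1/2}`. On a connected graph it does not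
depend on `o`. -/
def finiteEnergyClosure (o : X) : Set (X → ℂ) :=
  {f | G.energy f < ∞ ∧ ∀ ε : ℝ≥0∞, 0 < ε → ∃ φ : X → ℂ, φ.support.Finite ∧
    G.energy (f - φ) + ‖f o - φ o‖ₑ ^ 2 < ε}

/-- `(b, c)` is uniformly transient with constant `C`: the graph is connected and
`‖f‖_∞² ≤ C Q̃(f)` for every `f ∈ D̃₀`. -/
def IsUniformlyTransientWith (C : ℝ) : Prop :=
  G.toSimpleGraph.Connected ∧ 0 < C ∧
    ∀ o : X, ∀ f ∈ G.finiteEnergyClosure o, (⨆ x, ‖f x‖ₑ) ^ 2 ≤ ENNReal.ofReal C * G.energy f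

/-- The sesquilinear form of `Q̃`, conjugate linear in the first argument. -/
def energyForm (f g : X → ℂ) : ℂ :=
  2⁻¹ * ∑' p : X × X, (G.b p.1 p.2 : ℂ) * (conj (f p.1 - f p.2) * (g p.1 - g p.2)) +
    ∑' x, (G.c x : ℂ) * (conj (f x) * g x)

variable {G}

theorem enorm_add_sq_le (a b : ℂ) : ‖a + b‖ₑ ^ 2 ≤ 2 * (‖a‖ₑ ^ 2 + ‖b‖ₑ ^ 2) := by
  have h : ‖a + b‖₊ ^ 2 ≤ 2 * (‖a‖₊ ^ 2 + ‖b‖₊ ^ 2) :=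
    (pow_le_pow_left₀ (zero_le) (nnnorm_add_le a b) 2).trans add_sq_le
  simp only [enorm_eq_nnnorm]
  exact_mod_cast h

theorem energy_add_le (f g : X → ℂ) : G.energy (f + g) ≤ 2 * (G.energy f + G.energy g) := by
  have h1 : ∑' p : X × X, (G.b p.1 p.2 : ℝ≥0∞) * ‖(f + g) p.1 - (f + g) p.2‖ₑ ^ 2 ≤
      2 * (∑' p : X × X, (G.b p.1 p.2 : ℝ≥0∞) * ‖f p.1 - f p.2‖ₑ ^ 2 +
        ∑' p : X × X, (G.b p.1 p.2 : ℝ≥0∞) * ‖g p.1 - g p.2‖ₑ ^ 2) := by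
    rw [← ENNReal.tsum_add, ← ENNReal.tsum_mul_left]
    refine ENNReal.tsum_le_tsum fun p => ?_
    have := enorm_add_sq_le (f p.1 - f p.2) (g p.1 - g p.2)
    rw [show (f + g) p.1 - (f + g) p.2 = (f p.1 - f p.2) + (g p.1 - g p.2) by
      simp only [Pi.add_apply]; ring]
    calc _ ≤ (G.b p.1 p.2 : ℝ≥0∞) * _ := mul_le_mul_right this _
      _ = _ := by ring
  have h2 : ∑' x, (G.c x : ℝ≥0∞) * ‖(f + g) x‖ₑ ^ 2 ≤
      2 * (∑' x, (G.c x : ℝ≥0∞) * ‖f x‖ₑ ^ 2 + ∑' x, (G.c x : ℝ≥0∞) * ‖g x‖ₑ ^ 2) := by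
    rw [← ENNReal.tsum_add, ← ENNReal.tsum_mul_left]
    refine ENNReal.tsum_le_tsum fun x => ?_
    calc _ ≤ (G.c x : ℝ≥0∞) * _ := mul_le_mul_right (enorm_add_sq_le (f x) (g x)) _
      _ = _ := by ring
  unfold energy
  calc _ ≤ 2⁻¹ * (2 * (_ + _)) + 2 * (_ + _) := add_le_add (mul_le_mul_right h1 _) h2
    _ = _ := by ring

theorem energy_smul (a : ℂ) (f : X → ℂ) : G.energy (a • f) = ‖a‖ₑ ^ 2 * G.energy f := by
  unfold energy
  have h1 : ∀ p : X × X, (G.b p.1 p.2 : ℝ≥0∞) * ‖(a • f) p.1 - (a • f) p.2‖ₑ ^ 2 =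
      ‖a‖ₑ ^ 2 * ((G.b p.1 p.2 : ℝ≥0∞) * ‖f p.1 - f p.2‖ₑ ^ 2) := fun p => by
    rw [Pi.smul_apply, Pi.smul_apply, ← smul_sub, enorm_smul]; ring
  have h2 : ∀ x, (G.c x : ℝ≥0∞) * ‖(a • f) x‖ₑ ^ 2 =
      ‖a‖ₑ ^ 2 * ((G.c x : ℝ≥0∞) * ‖f x‖ₑ ^ 2) := fun x => by
    rw [Pi.smul_apply, enorm_smul]; ring
  simp only [h1, h2, ENNReal.tsum_mul_left]
  ring

theorem summable_conj_mul {ι : Type*} (w : ι → ℝ≥0) (u v : ι → ℂ)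
    (hu : ∑' i, (w i : ℝ≥0∞) * ‖u i‖ₑ ^ 2 ≠ ∞) (hv : ∑' i, (w i : ℝ≥0∞) * ‖v i‖ₑ ^ 2 ≠ ∞) :
    Summable fun i => (w i : ℂ) * (conj (u i) * v i) := by
  have key : ∀ u : ι → ℂ, ∑' i, (w i : ℝ≥0∞) * ‖u i‖ₑ ^ 2 ≠ ∞ →
      Summable fun i => (w i : ℝ) * ‖u i‖ ^ 2 := by
    intro u hu
    have h : Summable fun i => w i * ‖u i‖₊ ^ 2 := by
      rw [← ENNReal.tsum_coe_ne_top_iff_summable]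
      simpa [enorm_eq_nnnorm] using hu
    simpa using NNReal.summable_coe.2 h
  refine Summable.of_norm_bounded ((key u hu).add (key v hv)) fun i => ?_
  rw [norm_mul, norm_mul, RCLike.norm_conj, ← mul_add]
  have : ‖(w i : ℂ)‖ = (w i : ℝ) := by simp
  rw [this]
  refine mul_le_mul_of_nonneg_left ?_ (w i).2
  nlinarith [sq_nonneg (‖u i‖ - ‖v i‖), sq_nonneg ‖u i‖, sq_nonneg ‖v i‖]

theorem energy_parts {f : X → ℂ} (hf : G.energy f < ∞) :
    ∑' p : X × X, (G.b p.1 p.2 : ℝ≥0∞) * ‖f p.1 - f p.2‖ₑ ^ 2 ≠ ∞ ∧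
      ∑' x, (G.c x : ℝ≥0∞) * ‖f x‖ₑ ^ 2 ≠ ∞ := by
  unfold energy at hf
  rw [ENNReal.add_lt_top] at hf
  refine ⟨fun h => ?_, hf.2.ne⟩
  rw [h, ENNReal.mul_top (by simp)] at hf
  exact lt_irrefl _ hf.1

theorem summable_b_part {f g : X → ℂ} (hf : G.energy f < ∞) (hg : G.energy g < ∞) :
    Summable fun p : X × X => (G.b p.1 p.2 : ℂ) * (conj (f p.1 - f p.2) * (g p.1 - g p.2)) :=
  summable_conj_mul (fun p : X × X => G.b p.1 p.2) (fun p => f p.1 - f p.2)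
    (fun p => g p.1 - g p.2) (energy_parts hf).1 (energy_parts hg).1

theorem summable_c_part {f g : X → ℂ} (hf : G.energy f < ∞) (hg : G.energy g < ∞) :
    Summable fun x => (G.c x : ℂ) * (conj (f x) * g x) :=
  summable_conj_mul G.c f g (energy_parts hf).2 (energy_parts hg).2

/-- The form restricted to the diagonal is the energy. -/
theorem energyForm_self {f : X → ℂ} (hf : G.energy f < ∞) :
    G.energyForm f f = ((G.energy f).toReal : ℂ) := by
  have key : ∀ {ι : Type _} (w : ι → ℝ≥0) (u : ι → ℂ),
      ∑' i, (w i : ℂ) * (conj (u i) * u i) =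
        ((∑' i, (w i : ℝ≥0∞) * ‖u i‖ₑ ^ 2).toReal : ℂ) := by
    intro ι w u
    rw [ENNReal.tsum_toReal_eq
      (fun i => ENNReal.mul_ne_top ENNReal.coe_ne_top (ENNReal.pow_ne_top enorm_ne_top)),
      Complex.ofReal_tsum]
    refine tsum_congr fun i => ?_
    rw [mul_comm (conj (u i)), Complex.mul_conj, Complex.normSq_eq_norm_sq]
    simp
  unfold energyForm energy
  rw [ENNReal.toReal_add (ENNReal.mul_ne_top (by simp) (energy_parts hf).1) (energy_parts hf).2,
    key (fun p : X × X => G.b p.1 p.2) (fun p => f p.1 - f p.2), key G.c f]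
  simp

theorem energyForm_add_left {f f' g : X → ℂ} (hf : G.energy f < ∞) (hf' : G.energy f' < ∞)
    (hg : G.energy g < ∞) :
    G.energyForm (f + f') g = G.energyForm f g + G.energyForm f' g := by
  unfold energyForm
  rw [add_add_add_comm, ← mul_add, ← (summable_b_part hf hg).tsum_add (summable_b_part hf' hg),
    ← (summable_c_part hf hg).tsum_add (summable_c_part hf' hg)]
  congr 2
  · congr 1; funext p; simp only [Pi.add_apply, map_add, map_sub]; ring
  · funext x; simp only [Pi.add_apply, map_add]; ring

theorem energyForm_add_right {f g g' : X → ℂ} (hf : G.energy f < ∞) (hg : G.energy g < ∞)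
    (hg' : G.energy g' < ∞) :
    G.energyForm f (g + g') = G.energyForm f g + G.energyForm f g' := by
  unfold energyForm
  rw [add_add_add_comm, ← mul_add, ← (summable_b_part hf hg).tsum_add (summable_b_part hf hg'),
    ← (summable_c_part hf hg).tsum_add (summable_c_part hf hg')]
  congr 2
  · congr 1; funext p; simp only [Pi.add_apply]; ring
  · funext x; simp only [Pi.add_apply]; ring

theorem energyForm_smul_left (a : ℂ) (f g : X → ℂ) :
    G.energyForm (a • f) g = conj a * G.energyForm f g := by
  unfold energyForm
  rw [mul_add, mul_left_comm, ← tsum_mul_left (a := conj a), ← tsum_mul_left (a := conj a)]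
  congr 2
  · congr 1; funext p; simp only [Pi.smul_apply, smul_eq_mul, map_mul, map_sub]; ring
  · funext x; simp only [Pi.smul_apply, smul_eq_mul, map_mul]; ring

theorem energyForm_smul_right (a : ℂ) (f g : X → ℂ) :
    G.energyForm f (a • g) = a * G.energyForm f g := by
  unfold energyForm
  rw [mul_add, mul_left_comm, ← tsum_mul_left (a := a), ← tsum_mul_left (a := a)]
  congr 2
  · congr 1; funext p; simp only [Pi.smul_apply, smul_eq_mul]; ring
  · funext x; simp only [Pi.smul_apply, smul_eq_mul]; ring

open Classical in
theorem energy_single_lt_top (G : WeightedGraph X) (x : X) :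
    G.energy (Pi.single x 1) < ∞ := by
  have hsum : ∑' y, (G.b x y : ℝ≥0∞) ≠ ∞ :=
    ENNReal.tsum_coe_ne_top_iff_summable.2 (G.b_summable x)
  have h1 : ∑' p : X × X, (G.b p.1 p.2 : ℝ≥0∞) *
      ‖(Pi.single x 1 : X → ℂ) p.1 - (Pi.single x 1 : X → ℂ) p.2‖ₑ ^ 2 ≤
      ∑' y, (G.b x y : ℝ≥0∞) + ∑' y, (G.b x y : ℝ≥0∞) := by
    calc _ ≤ ∑' p : X × X, ((if p.1 = x then (G.b x p.2 : ℝ≥0∞) else 0) +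
            (if p.2 = x then (G.b x p.1 : ℝ≥0∞) else 0)) := by
          refine ENNReal.tsum_le_tsum fun p => ?_
          by_cases h1 : p.1 = x <;> by_cases h2 : p.2 = x
          · simp [h1, h2]
          · simp [h1, h2]
          · simp [h1, h2, G.b_symm x]
          · simp [h1, h2]
      _ = _ := by
          rw [ENNReal.tsum_add, ENNReal.tsum_prod', ENNReal.tsum_prod']
          congr 1
          · rw [tsum_eq_single x (fun y hy => by simp [hy])]
            simp
          · refine tsum_congr fun y => ?_
            rw [tsum_eq_single x (fun z hz => by simp [hz])]
            simp
  have h2 : ∑' y, (G.c y : ℝ≥0∞) * ‖(Pi.single x 1 : X → ℂ) y‖ₑ ^ 2 = G.c x := by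
    rw [tsum_eq_single x (fun y hy => by simp [hy])]
    simp
  unfold energy
  rw [h2]
  refine ENNReal.add_lt_top.2 ⟨ENNReal.mul_lt_top (by simp) (h1.trans_lt ?_), ENNReal.coe_lt_top⟩
  exact ENNReal.add_lt_top.2 ⟨hsum.lt_top, hsum.lt_top⟩

/-! ### The Dirichlet form and the Dirichlet Laplacian -/

variable [MeasurableSpace X] [DiscreteMeasurableSpace X] (G) (m : VertexMeasure X)

/-- The square of the form norm: `Q̃(f) + ‖f‖₂²`. -/
def formNormSq (f : X → ℂ) : ℝ≥0∞ := G.energy f + eLpNorm f 2 m.toMeasure ^ 2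

variable {G m} in
theorem formNormSq_add_le (f g : X → ℂ) :
    G.formNormSq m (f + g) ≤ 2 * (G.formNormSq m f + G.formNormSq m g) := by
  have h1 : eLpNorm (f + g) 2 m.toMeasure ≤ eLpNorm f 2 m.toMeasure + eLpNorm g 2 m.toMeasure :=
    eLpNorm_add_le (Measurable.of_discrete.aestronglyMeasurable)
      (Measurable.of_discrete.aestronglyMeasurable) (by norm_num)
  have h2 : eLpNorm (f + g) 2 m.toMeasure ^ 2 ≤
      2 * (eLpNorm f 2 m.toMeasure ^ 2 + eLpNorm g 2 m.toMeasure ^ 2) := by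
    refine (pow_le_pow_left₀ (zero_le) h1 2).trans ?_
    have h := ENNReal.rpow_add_le_mul_rpow_add_rpow (eLpNorm f 2 m.toMeasure)
      (eLpNorm g 2 m.toMeasure) (p := 2) (by norm_num)
    norm_num at h
    exact h
  unfold formNormSq
  calc _ ≤ 2 * (_ + _) + 2 * (_ + _) := add_le_add (energy_add_le f g) h2
    _ = _ := by ring

variable {G m} in
theorem formNormSq_smul (a : ℂ) (f : X → ℂ) :
    G.formNormSq m (a • f) = ‖a‖ₑ ^ 2 * G.formNormSq m f := by
  unfold formNormSq
  rw [energy_smul, eLpNorm_const_smul, mul_pow, mul_add]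

/-- `D(Q^{(D)})`: the domain of the closure in `ℓ²(X, m)` of the restriction of `Q̃` to the finitely
supported functions, that is, the closure of these functions with respect to the form norm inside
`{f ∈ ℓ²(X, m) | Q̃(f) < ∞}` (on which `Q̃` is a closed form). -/
def dirichletDomain : Submodule ℂ m.l2 where
  carrier := {f | G.energy f < ∞ ∧ ∀ ε : ℝ≥0∞, 0 < ε → ∃ φ : X → ℂ, φ.support.Finite ∧
    G.formNormSq m (f - φ) < ε}
  zero_mem' := by
    have h0 : G.formNormSq m 0 = 0 := by simp [formNormSq, energy]
    refine ⟨?_, fun ε hε => ⟨0, by simp, ?_⟩⟩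
    · rw [m.coe_zero]; simp [energy]
    · rw [m.coe_zero, sub_zero, h0]; exact hε
  add_mem' := by
    rintro f g ⟨hf, hf'⟩ ⟨hg, hg'⟩
    rw [Set.mem_ofPred_eq, m.coe_add]
    refine ⟨(energy_add_le _ _).trans_lt
      (ENNReal.mul_lt_top (by simp) (ENNReal.add_lt_top.2 ⟨hf, hg⟩)), fun ε hε => ?_⟩
    have hε' : 0 < ε / 2 / 2 := ENNReal.half_pos (ENNReal.half_pos hε.ne').ne'
    obtain ⟨φ, hφ, h1⟩ := hf' _ hε'
    obtain ⟨ψ, hψ, h2⟩ := hg' _ hε'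
    refine ⟨φ + ψ, (hφ.union hψ).subset (Function.support_add φ ψ), ?_⟩
    rw [add_sub_add_comm]
    refine (formNormSq_add_le _ _).trans_lt ?_
    have h3 : G.formNormSq m (f - φ) + G.formNormSq m (g - ψ) < ε / 2 := by
      refine (ENNReal.add_lt_add h1 h2).trans_le (le_of_eq (ENNReal.add_halves _))
    rw [mul_comm]
    exact (ENNReal.lt_div_iff_mul_lt (by simp) (by simp)).1 h3
  smul_mem' := by
    rintro a f ⟨hf, hf'⟩
    rw [Set.mem_ofPred_eq, m.coe_smul]
    refine ⟨?_, fun ε hε => ?_⟩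
    · rw [energy_smul]
      exact ENNReal.mul_lt_top (ENNReal.pow_lt_top enorm_lt_top) hf
    by_cases ha : a = 0
    · refine ⟨0, by simp, ?_⟩
      simpa [ha, formNormSq, energy] using hε
    have ha1 : ‖a‖ₑ ^ 2 ≠ 0 := by simpa using ha
    have ha2 : ‖a‖ₑ ^ 2 ≠ ∞ := ENNReal.pow_ne_top enorm_ne_top
    obtain ⟨φ, hφ, h1⟩ := hf' (ε / ‖a‖ₑ ^ 2) (ENNReal.div_pos hε.ne' ha2)
    refine ⟨a • φ, hφ.subset (Function.support_const_smul_subset a φ), ?_⟩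
    rw [← smul_sub, formNormSq_smul, mul_comm]
    exact (ENNReal.lt_div_iff_mul_lt (Or.inl ha1) (Or.inl ha2)).1 h1

/-- The Dirichlet form `Q^{(D)}` as a sesquilinear form on `D(Q^{(D)})`. -/
def dirichletForm : G.dirichletDomain m →ₗ⋆[ℂ] G.dirichletDomain m →ₗ[ℂ] ℂ :=
  LinearMap.mk₂'ₛₗ (starRingEnd ℂ) (RingHom.id ℂ)
    (fun f g => G.energyForm (f : m.l2) (g : m.l2))
    (fun f f' g => by
      rw [Submodule.coe_add, m.coe_add, energyForm_add_left f.2.1 f'.2.1 g.2.1])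
    (fun a f g => by
      rw [Submodule.coe_smul, m.coe_smul, energyForm_smul_left, smul_eq_mul])
    (fun f g g' => by
      rw [Submodule.coe_add, m.coe_add, energyForm_add_right f.2.1 g.2.1 g'.2.1])
    (fun a f g => by
      rw [Submodule.coe_smul, m.coe_smul, energyForm_smul_right, RingHom.id_apply, smul_eq_mul])

/-- The Dirichlet Laplacian `L^{(D)}`: the generator of `Q^{(D)}` on `ℓ²(X, m)`. -/
def dirichletLaplacian : m.l2 →ₗ.[ℂ] m.l2 :=
  UnboundedOp.formGenerator (G.dirichletDomain m) (G.dirichletForm m)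

/-- `Q^{(D)}` is densely defined. -/
theorem dense_dirichletDomain : Dense (G.dirichletDomain m : Set m.l2) := by
  classical
  have hfin : ∀ x, m.toMeasure {x} ≠ ∞ := fun x => by simp [m.toMeasure_singleton]
  rw [Submodule.dense_iff_topologicalClosure_eq_top,
    Submodule.topologicalClosure_eq_top_iff, Submodule.eq_bot_iff]
  intro g hg
  have hval : ∀ x, (g : X → ℂ) x = 0 := by
    intro x
    let e : m.l2 := indicatorConstLp 2 (measurableSet_singleton x) (hfin x) (1 : ℂ)
    have he : (e : X → ℂ) = Pi.single x 1 := by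
      rw [m.eq_of_ae_eq (indicatorConstLp_coeFn (s := {x}) (hs := measurableSet_singleton x)
        (hμs := hfin x) (c := (1 : ℂ)) (p := 2))]
      funext y
      by_cases hy : y = x <;> simp [hy]
    have hmem : e ∈ G.dirichletDomain m := by
      refine ⟨?_, fun ε hε => ⟨Pi.single x 1, ?_, ?_⟩⟩
      · rw [he]; exact energy_single_lt_top G x
      · exact (Set.finite_singleton x).subset Pi.support_single_subset
      · rw [he, sub_self]; simpa [formNormSq, energy] using hε
    have h0 : inner ℂ e g = 0 := hg e hmem
    rw [L2.inner_indicatorConstLp_one, Measure.restrict_singleton, integral_smul_measure,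
      integral_dirac] at h0
    rcases smul_eq_zero.1 h0 with h | h
    · rw [m.toMeasure_singleton] at h
      exact absurd h (by simpa using (m.pos x).ne')
    · exact h
  apply Lp.ext
  rw [m.coe_zero, funext hval]
  rfl

end WeightedGraph

end

/-! Uniform transience embeds the form domain into the bounded functions, `|f(x)|² ≤ C Q(f)` at
every vertex (`norm_apply_sq_le`). Since `m` is finite, integrating gives the Poincaré inequality
`‖f‖² ≤ C m(X) Q(f)`, so the closed form is coercive and the Laplacian has a bounded symmetric
inverse `A`. Integrating only off a finite set `F` gives `‖f - 1_F f‖² ≤ C m(X \ F) Q(f)`. Hence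
finite-rank operators approximate `A` in norm, and `A` is compact. Everything about the spectrum
except the constant now follows from the theory of compact symmetric operators.

The constant comes from a trace bound (`sum_inv_eigenvalue_le`). For orthonormal eigenvectors `v_i`
with eigenvalues `t_i`, the function `f = ∑ a_i v_i` has `Q(f) = ∑ |a_i|² t_i`. The pointwise bound
with the extremal choice `a_i = conj (v_i(x)) / t_i` becomes `∑ |v_i(x)|² / t_i ≤ C`, and summing
over `x` against `m` yields `∑ 1/t_i ≤ C m(X)`. If `k` eigenvalues are at most `λ`, then `k/λ ≤ C
m(X)`. -/

/-! ### Listing a locally finite family of multiplicities. -/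

/-- An infinite linear order all of whose initial segments are finite is isomorphic to `ℕ`. -/
theorem nonempty_orderIso_nat_of_finite_Iic {L : Type*} [LinearOrder L] [Infinite L]
    (hIic : ∀ i : L, (Set.Iic i).Finite) : Nonempty (L ≃o ℕ) := by
  let _ : LocallyFiniteOrder L := LocallyFiniteOrder.ofFiniteIcc fun i j =>
    (hIic j).subset fun _ h => h.2
  let _ : SuccOrder L := LinearLocallyFiniteOrder.succOrder L
  let _ : PredOrder L := LinearLocallyFiniteOrder.predOrder L
  have _ : NoMaxOrder L := ⟨fun i => by
    by_contra! h
    exact Set.infinite_univ ((hIic i).subset fun j _ => Set.mem_Iic.2 (h j))⟩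
  obtain ⟨i₀⟩ : Nonempty L := inferInstance
  obtain ⟨b, hb⟩ := (hIic i₀).exists_minimal ⟨i₀, Set.mem_Iic.2 le_rfl⟩
  let _ : OrderBot L :=
    { bot := b
      bot_le := fun j => by
        rcases le_total b j with h | h
        · exact h
        · exact hb.2 (h.trans hb.1) h }
  exact ⟨orderIsoNatOfLinearSuccPredArch⟩

/-- A family of multiplicities `d` on the real line with finitely many members below every bound
and infinitely many in total can be listed in nondecreasing order. -/
theorem exists_equiv_nat_monotone_fst (d : ℝ → ℕ) [Infinite (Σ t : ℝ, Fin (d t))]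
    (hfin : ∀ R : ℝ, {i : Σ t : ℝ, Fin (d t) | i.1 ≤ R}.Finite) :
    ∃ e : ℕ ≃ (Σ t : ℝ, Fin (d t)), Monotone fun k => (e k).1 := by
  -- The lexicographic order on pairs (value, index) breaks ties between equal values. It is total,
  -- and each initial segment lies in a set covered by `hfin`.
  have hfst : ∀ {i j : Σₗ t : ℝ, Fin (d t)}, i ≤ j → (ofLex i).1 ≤ (ofLex j).1 := by
    intro i j h
    rcases Sigma.Lex.le_def.1 h with h | ⟨h, -⟩
    · exact h.le
    · exact h.le
  have _ : Infinite (Σₗ t : ℝ, Fin (d t)) := inferInstanceAs (Infinite (Σ t : ℝ, Fin (d t)))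
  obtain ⟨e⟩ := nonempty_orderIso_nat_of_finite_Iic fun i : Σₗ t : ℝ, Fin (d t) =>
    (hfin (ofLex i).1).subset fun j hj => hfst (Set.mem_Iic.1 hj)
  exact ⟨e.symm.toEquiv.trans ofLex, fun k l h => hfst (e.symm.monotone h)⟩

/-! ### Closed coercive forms and their solution operators. -/

/-- The Riesz representation theorem for a complete inner product `c`. -/
theorem exists_riesz_of_core {V : Type*} [AddCommGroup V] [Module ℂ V]
    (c : InnerProductSpace.Core ℂ V)
    (hc : ∀ u : ℕ → V,
      (∀ ε > 0, ∃ N, ∀ k ≥ N, ∀ n ≥ N, (c.inner (u k - u n) (u k - u n)).re < ε) →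
      ∃ v, ∀ ε > 0, ∃ N, ∀ n ≥ N, (c.inner (u n - v) (u n - v)).re < ε)
    (ℓ : V →ₗ[ℂ] ℂ) (M : ℝ) (hM : 0 ≤ M) (hℓ : ∀ v, ‖ℓ v‖ ^ 2 ≤ M * (c.inner v v).re) :
    ∃ f, ∀ h, c.inner f h = ℓ h := by
  let _ : NormedAddCommGroup V := c.toNormedAddCommGroup
  let _ : InnerProductSpace ℂ V := InnerProductSpace.ofCore c.toCore
  have hn : ∀ v : V, (c.inner v v).re = ‖v‖ ^ 2 := fun v => (norm_sq_eq_re_inner (𝕜 := ℂ) v).symm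
  have key : ∀ {ε : ℝ}, 0 < ε → ∀ v : V, (c.inner v v).re < ε ^ 2 ↔ ‖v‖ < ε := fun hε v => by
    rw [hn]
    exact pow_lt_pow_iff_left₀ (norm_nonneg _) hε.le two_ne_zero
  have _ : CompleteSpace V := by
    refine Metric.complete_of_cauchySeq_tendsto fun u hu => ?_
    obtain ⟨v, hv⟩ := hc u fun ε hε => by
      obtain ⟨N, hN⟩ := Metric.cauchySeq_iff.1 hu (√ε) (Real.sqrt_pos.2 hε)
      refine ⟨N, fun k hk n hn' => ?_⟩
      have := hN k hk n hn'
      rw [dist_eq_norm, ← key (Real.sqrt_pos.2 hε), Real.sq_sqrt hε.le] at this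
      exact this
    refine ⟨v, Metric.tendsto_atTop.2 fun ε hε => ?_⟩
    obtain ⟨N, hN⟩ := hv (ε ^ 2) (by positivity)
    refine ⟨N, fun n hn' => ?_⟩
    rw [dist_eq_norm, ← key hε]
    exact hN n hn'
  let ℓ' : V →L[ℂ] ℂ := ℓ.mkContinuous (√M) fun v => by
    refine le_of_sq_le_sq ?_ (by positivity)
    rw [mul_pow, Real.sq_sqrt hM, ← hn]
    exact hℓ v
  refine ⟨(InnerProductSpace.toDual ℂ V).symm ℓ', fun h => ?_⟩
  exact InnerProductSpace.toDual_symm_apply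

namespace UnboundedOp

variable {H : Type*} [NormedAddCommGroup H] [InnerProductSpace ℂ H]

/-- A complete coercive form has a bounded symmetric solution operator. -/
theorem exists_solutionOperator (D : Submodule ℂ H) (q : D →ₗ⋆[ℂ] D →ₗ[ℂ] ℂ)
    (hsymm : ∀ f g, conj (q f g) = q g f) (K : ℝ) (hK : 0 ≤ K)
    (hcoer : ∀ f : D, ‖(f : H)‖ ^ 2 ≤ K * (q f f).re)
    (hcomplete : ∀ u : ℕ → D,
      (∀ ε > 0, ∃ N, ∀ k ≥ N, ∀ n ≥ N, (q (u k - u n) (u k - u n)).re < ε) →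
      ∃ v, ∀ ε > 0, ∃ N, ∀ n ≥ N, (q (u n - v) (u n - v)).re < ε)
    (hpos : ∀ f, 0 ≤ (q f f).re) :
    ∃ A : H →L[ℂ] H, (A : H →ₗ[ℂ] H).IsSymmetric ∧
      ∀ f g, (f, g) ∈ formGraph D q ↔ f = A g := by
  have hdef : ∀ f : D, q f f = 0 → f = 0 := fun f hf => by
    have := hcoer f
    rw [hf, Complex.zero_re, mul_zero] at this
    have h0 : ‖(f : H)‖ = 0 := by nlinarith [norm_nonneg (f : H)]
    exact Subtype.ext (norm_eq_zero.1 h0)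
  let c : InnerProductSpace.Core ℂ D :=
    { inner := fun f g => q f g
      conj_inner_symm := fun f g => hsymm g f
      re_inner_nonneg := hpos
      add_left := fun f g h => by simp
      smul_left := fun f g a => by simp
      definite := hdef }
  -- Coercivity makes `v ↦ ⟪u, v⟫` bounded in the form norm. Riesz puts the solution in the
  -- conjugate-linear slot of `q`, and `hsymm` moves it to the linear one.
  have hex : ∀ u : H, ∃ f : D, ∀ v : D, q v f = inner ℂ (v : H) u := by
    intro u
    obtain ⟨f, hf⟩ := exists_riesz_of_core c hcomplete ((innerSL ℂ u).toLinearMap ∘ₗ D.subtype)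
      (‖u‖ ^ 2 * K) (by positivity) fun v => by
        calc ‖inner ℂ u (v : H)‖ ^ 2 ≤ (‖u‖ * ‖(v : H)‖) ^ 2 :=
              pow_le_pow_left₀ (norm_nonneg _) (norm_inner_le_norm _ _) 2
          _ = ‖u‖ ^ 2 * ‖(v : H)‖ ^ 2 := mul_pow _ _ _
          _ ≤ ‖u‖ ^ 2 * (K * (q v v).re) := by gcongr; exact hcoer v
          _ = _ := by rw [mul_assoc]; rfl
    refine ⟨f, fun v => ?_⟩
    have h1 : q f v = inner ℂ u (v : H) := hf v
    rw [← hsymm, h1, inner_conj_symm]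
  choose S hS using hex
  -- Uniqueness of solutions makes the chosen `S` linear.
  have huniq : ∀ f g : D, (∀ v, q v f = q v g) → f = g := fun f g h => by
    rw [← sub_eq_zero]
    apply hdef
    rw [map_sub (q (f - g)), h, sub_self]
  let A₀ : H →ₗ[ℂ] D :=
    { toFun := S
      map_add' := fun u w => huniq _ _ fun v => by
        rw [map_add, hS, hS, hS, inner_add_right]
      map_smul' := fun a u => huniq _ _ fun v => by
        rw [map_smul, hS, RingHom.id_apply, hS, inner_smul_right, smul_eq_mul] }
  have hbd : ∀ u, ‖(S u : H)‖ ≤ K * ‖u‖ := fun u => by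
    have h1 := hcoer (S u)
    have h2 : (q (S u) (S u)).re ≤ ‖(S u : H)‖ * ‖u‖ := by
      rw [hS]
      exact (Complex.re_le_norm _).trans (norm_inner_le_norm _ _)
    rcases (norm_nonneg (S u : H)).eq_or_lt with h | h
    · rw [← h]; positivity
    · have := mul_le_mul_of_nonneg_left h2 hK
      nlinarith
  refine ⟨(D.subtype ∘ₗ A₀).mkContinuous K hbd, fun u w => ?_, fun f g => ⟨?_, ?_⟩⟩
  · change inner ℂ (S u : H) w = inner ℂ u (S w : H)
    rw [← hS, ← hsymm, hS, inner_conj_symm]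
  · rintro ⟨hf, h⟩
    exact congrArg Subtype.val (huniq ⟨f, hf⟩ (S g) fun v => by rw [h, hS])
  · rintro rfl
    exact ⟨(S g).2, hS g⟩

/-- The solution operator of a form is compact if compact operators approximate the identity in the
form sense. -/
theorem isCompactOperator_solutionOperator [CompleteSpace H] (D : Submodule ℂ H)
    (q : D →ₗ⋆[ℂ] D →ₗ[ℂ] ℂ) {A : H →L[ℂ] H}
    (hA : ∀ f g, (f, g) ∈ formGraph D q ↔ f = A g)
    (happrox : ∀ ε > 0, ∃ P : H →L[ℂ] H, IsCompactOperator P ∧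
      ∀ f : D, ‖(f : H) - P f‖ ^ 2 ≤ ε * (q f f).re) : IsCompactOperator A := by
  refine isClosed_setOfPred_isCompactOperator.closure_subset
    (Metric.mem_closure_iff.2 fun r hr => ?_)
  -- On the range of `A` the form satisfies `q(Au, Au) ≤ ‖A‖ ‖u‖²`, so this `ε` yields `‖A - PA‖ ≤
  -- r/2`; the `+ 1` avoids dividing by zero.
  obtain ⟨P, hP, hPf⟩ := happrox ((r / 2) ^ 2 / (‖A‖ + 1)) (by positivity)
  refine ⟨P.comp A, hP.comp_clm A, ?_⟩
  rw [dist_eq_norm]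
  refine lt_of_le_of_lt (ContinuousLinearMap.opNorm_le_bound _ (half_pos hr).le fun u => ?_)
    (half_lt_self hr)
  obtain ⟨h1, h2⟩ := (hA (A u) u).2 rfl
  have h3 : (q ⟨A u, h1⟩ ⟨A u, h1⟩).re ≤ (‖A‖ + 1) * ‖u‖ ^ 2 := by
    rw [h2]
    calc _ ≤ ‖A u‖ * ‖u‖ := (Complex.re_le_norm _).trans (norm_inner_le_norm _ _)
      _ ≤ (‖A‖ * ‖u‖) * ‖u‖ := by gcongr; exact A.le_opNorm u
      _ ≤ _ := by nlinarith [sq_nonneg ‖u‖]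
  refine le_of_sq_le_sq ?_ (by positivity)
  calc ‖(A - P.comp A) u‖ ^ 2 ≤ (r / 2) ^ 2 / (‖A‖ + 1) * (q ⟨A u, h1⟩ ⟨A u, h1⟩).re :=
        hPf ⟨A u, h1⟩
    _ ≤ (r / 2) ^ 2 / (‖A‖ + 1) * ((‖A‖ + 1) * ‖u‖ ^ 2) := by gcongr
    _ = _ := by field_simp

theorem mem_eigenspace_iff {T : H →ₗ.[ℂ] H} {z : ℂ} {f : H} :
    f ∈ eigenspace T z ↔ (f, z • f) ∈ T.graph := by
  rw [LinearPMap.mem_graph_iff]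
  constructor
  · rintro ⟨y, hy, rfl⟩
    exact ⟨y, rfl, by simpa [sub_eq_zero] using hy⟩
  · rintro ⟨y, rfl, hy⟩
    exact ⟨y, by simpa [sub_eq_zero] using hy, rfl⟩

/-- The eigenvalues of the generator of a coercive symmetric form are positive. -/
theorem exists_pos_eq_of_eigenspace_ne_bot (D : Submodule ℂ H) (hD : Dense (D : Set H))
    (q : D →ₗ⋆[ℂ] D →ₗ[ℂ] ℂ) (hsymm : ∀ f g, conj (q f g) = q g f) (K : ℝ) (hK : 0 ≤ K)
    (hcoer : ∀ f : D, ‖(f : H)‖ ^ 2 ≤ K * (q f f).re) {z : ℂ}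
    (hz : eigenspace (formGenerator D q) z ≠ ⊥) : ∃ t : ℝ, 0 < t ∧ z = t := by
  obtain ⟨f, hf, hf0⟩ := Submodule.exists_mem_ne_zero_of_ne_bot hz
  rw [mem_eigenspace_iff, graph_formGenerator hD] at hf
  obtain ⟨h1, h2⟩ := hf
  have h3 := h2 ⟨f, h1⟩
  have hn : 0 < ‖f‖ ^ 2 := by positivity
  have hc := hcoer ⟨f, h1⟩
  -- Symmetry makes `q(f, f) = z ‖f‖²` real, and coercivity makes it positive.
  have hreal := hsymm ⟨f, h1⟩ ⟨f, h1⟩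
  rw [Complex.conj_eq_iff_re] at hreal
  simp only at h3 hc
  rw [inner_smul_right, inner_self_eq_norm_sq_to_K] at h3
  refine ⟨(q ⟨f, h1⟩ ⟨f, h1⟩).re / ‖f‖ ^ 2, div_pos ?_ hn, ?_⟩
  · by_contra! h
    nlinarith [mul_nonneg hK (neg_nonneg.2 h)]
  · rw [Complex.ofReal_div, hreal, h3]
    have : ((‖f‖ : ℝ) : ℂ) ≠ 0 := by simpa using hf0
    push_cast
    field_simp
    simp

end UnboundedOp

/-! ### Operators with a compact symmetric inverse. -/

namespace UnboundedOp

variable {H : Type*} [NormedAddCommGroup H] [InnerProductSpace ℂ H]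

/-- The hypothesis `hTA`, shared by the results below, says that the graph of `T` is the flipped
graph of `A`, so `A` is an everywhere defined inverse of `T`. Injectivity of `A` is then
single-valuedness of `T`. -/
theorem injective_of_mem_graph_iff {T : H →ₗ.[ℂ] H} {A : H →L[ℂ] H}
    (hTA : ∀ f g, (f, g) ∈ T.graph ↔ f = A g) {g : H} (hg : A g = 0) : g = 0 :=
  T.graph_fst_eq_zero_snd ((hTA 0 g).2 hg.symm) rfl

theorem eigenspace_zero_eq_bot {T : H →ₗ.[ℂ] H} {A : H →L[ℂ] H}
    (hTA : ∀ f g, (f, g) ∈ T.graph ↔ f = A g) : eigenspace T 0 = ⊥ := by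
  refine (Submodule.eq_bot_iff _).2 fun f hf => ?_
  rw [mem_eigenspace_iff, zero_smul, hTA, map_zero] at hf
  exact hf

/-- The eigenspaces of an operator are those of its inverse. -/
theorem eigenspace_eq_inv {T : H →ₗ.[ℂ] H} {A : H →L[ℂ] H}
    (hTA : ∀ f g, (f, g) ∈ T.graph ↔ f = A g) {z : ℂ} (hz : z ≠ 0) :
    eigenspace T z = Module.End.eigenspace (A : H →ₗ[ℂ] H) z⁻¹ := by
  ext f
  rw [mem_eigenspace_iff, hTA, Module.End.mem_eigenspace_iff, map_smul,
    ContinuousLinearMap.coe_coe, eq_comm, eq_inv_smul_iff₀ hz]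

theorem zero_notMem_spectrum {T : H →ₗ.[ℂ] H} {A : H →L[ℂ] H}
    (hTA : ∀ f g, (f, g) ∈ T.graph ↔ f = A g) : (0 : ℂ) ∉ spectrum T := by
  refine not_not.2 ⟨A, fun u => ?_, fun u => ?_⟩
  · obtain ⟨y, hy, h⟩ := (LinearPMap.mem_graph_iff T).1 ((hTA (A u) u).2 rfl)
    dsimp only at hy h
    refine ⟨hy ▸ y.2, ?_⟩
    rw [zero_smul, sub_zero]
    exact (congrArg T.toFun (Subtype.ext hy.symm)).trans h
  · rw [zero_smul, sub_zero]
    exact ((hTA u (T u)).1 (T.mem_graph u)).symm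

/-- Every spectral value of an operator with compact inverse is an eigenvalue. -/
theorem eigenspace_ne_bot_of_mem_spectrum {T : H →ₗ.[ℂ] H} {A : H →L[ℂ] H}
    (hTA : ∀ f g, (f, g) ∈ T.graph ↔ f = A g) [CompleteSpace H] (hA : IsCompactOperator A)
    {z : ℂ} (hz : z ∈ spectrum T) : eigenspace T z ≠ ⊥ := by
  have hz0 : z ≠ 0 := fun h => zero_notMem_spectrum hTA (h ▸ hz)
  rw [eigenspace_eq_inv hTA hz0]
  change Module.End.HasEigenvalue _ _
  -- Fredholm alternative: a nonzero spectral value of a compact operator is an eigenvalue. It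
  -- remains to show that `z⁻¹` in the resolvent set of `A` puts `z` in that of `T`.
  rw [hA.hasEigenvalue_iff_mem_spectrum (inv_ne_zero hz0)]
  intro hres
  rw [spectrum.mem_resolventSet_iff] at hres
  obtain ⟨B, hB⟩ := hres
  have hB' : ∀ u, (B : H →L[ℂ] H) u = z⁻¹ • u - A u := fun u => by
    rw [hB]
    simp [Algebra.algebraMap_eq_smul_one]
  have hBi : ∀ u, (B : H →L[ℂ] H) ((↑B⁻¹ : H →L[ℂ] H) u) = u := fun u => by
    rw [← mul_apply_eq_comp, Units.mul_inv, one_apply_eq_self]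
  have hiB : ∀ u, (↑B⁻¹ : H →L[ℂ] H) ((B : H →L[ℂ] H) u) = u := fun u => by
    rw [← mul_apply_eq_comp, Units.inv_mul, one_apply_eq_self]
  -- `(T - z) w = u` means `w = A (z w + u)`, that is, `(z⁻¹ - A) w = z⁻¹ A u`; with `B = z⁻¹ - A`
  -- this gives the resolvent.
  refine hz ⟨z⁻¹ • ((↑B⁻¹ : H →L[ℂ] H) * A), fun u => ?_, fun u => ?_⟩
  · set w := (z⁻¹ • ((↑B⁻¹ : H →L[ℂ] H) * A)) u with hw
    have h1 : z⁻¹ • w - A w = z⁻¹ • A u := by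
      rw [← hB', hw]
      simp [hBi]
    have h2 : w = A (z • w + u) := by
      rw [map_add, map_smul]
      have := congrArg (fun y => z • y) h1
      simp only [smul_sub, smul_inv_smul₀ hz0] at this
      rw [← this]
      abel
    obtain ⟨y, hy, h⟩ := (LinearPMap.mem_graph_iff T).1 ((hTA _ _).2 h2)
    dsimp only at hy h
    refine ⟨hy ▸ y.2, ?_⟩
    have : T ⟨w, hy ▸ y.2⟩ = T y := congrArg T.toFun (Subtype.ext hy.symm)
    rw [this, h]
    abel
  · have h1 : (u : H) = A (T u) := (hTA u (T u)).1 (T.mem_graph u)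
    have h2 : A (T u - z • (u : H)) = z • (B : H →L[ℂ] H) (u : H) := by
      rw [map_sub, ← h1, map_smul, hB', smul_sub, smul_inv_smul₀ hz0]
    simp [h2, hiB, smul_smul, hz0]

/-- If the inverse of `T` is compact and symmetric, the eigenvalues of `T` are positive, and the
sums of reciprocal eigenvalues along orthonormal families of eigenvectors are at most `K`, then
the spectrum of `T` is purely discrete and the `k`-th eigenvalue is at least `k / K`. -/
theorem hasPurelyDiscreteSpectrum_and_exists_eigenvalueSequence [CompleteSpace H]
    (hH : ¬ FiniteDimensional ℂ H) {T : H →ₗ.[ℂ] H} {A : H →L[ℂ] H}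
    (hTA : ∀ f g, (f, g) ∈ T.graph ↔ f = A g) (hA : IsCompactOperator A)
    (hsymm : (A : H →ₗ[ℂ] H).IsSymmetric) {K : ℝ} (hK : 0 < K)
    (hpos : ∀ z : ℂ, eigenspace T z ≠ ⊥ → ∃ t : ℝ, 0 < t ∧ z = t)
    (htrace : ∀ (ι : Type) (s : Finset ι) (v : ι → H) (t : ι → ℝ), Orthonormal ℂ v →
      (∀ i, 0 < t i) → (∀ i, (v i, (t i : ℂ) • v i) ∈ T.graph) → ∑ i ∈ s, (t i)⁻¹ ≤ K) :
    HasPurelyDiscreteSpectrum T ∧ ∃ ev : ℕ → ℝ, IsEigenvalueSequence T ev ∧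
      ∀ k : ℕ, ev k ≥ (k + 1 : ℝ) / K := by
  have hfd : ∀ z : ℂ, FiniteDimensional ℂ (eigenspace T z) := fun z => by
    by_cases hz : z = 0
    · rw [hz, eigenspace_zero_eq_bot hTA]
      infer_instance
    · rw [eigenspace_eq_inv hTA hz]
      exact ContinuousLinearMap.finite_dimensional_eigenspace hA _ (inv_ne_zero hz)
  -- One index for each vector of an orthonormal basis of each eigenspace with real eigenvalue; `Fin
  -- (d t)` is empty when `t` is not an eigenvalue.
  let d : ℝ → ℕ := fun t => Module.finrank ℂ (eigenspace T (t : ℂ))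
  let ι := Σ t : ℝ, Fin (d t)
  let v : ι → H := fun i => (stdOrthonormalBasis ℂ (eigenspace T (i.1 : ℂ)) i.2 : H)
  have hvmem : ∀ i, v i ∈ eigenspace T (i.1 : ℂ) := fun i => Subtype.prop _
  have hgraph : ∀ i, (v i, (i.1 : ℂ) • v i) ∈ T.graph := fun i => mem_eigenspace_iff.1 (hvmem i)
  have hvpos : ∀ i : ι, 0 < i.1 := fun i => by
    obtain ⟨t, ht, h⟩ := hpos (i.1 : ℂ) fun h => by
      have : d i.1 = 0 := by simp only [d]; rw [h, finrank_bot]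
      exact (Fin.cast this i.2).elim0
    rw [Complex.ofReal_inj] at h
    exact h ▸ ht
  have hgsymm : ∀ {f g f' g' : H}, (f, g) ∈ T.graph → (f', g') ∈ T.graph →
      inner ℂ g f' = inner ℂ f g' := fun h h' => by
    rw [hTA] at h h'
    rw [h, h']
    exact (hsymm _ _).symm
  have horth : Orthonormal ℂ v := by
    classical
    refine orthonormal_iff_ite.2 fun i j => ?_
    obtain ⟨t, i⟩ := i
    obtain ⟨t', j⟩ := j
    by_cases h : t = t'
    · subst h
      have := orthonormal_iff_ite.1 (stdOrthonormalBasis ℂ (eigenspace T (t : ℂ))).orthonormal i j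
      rw [Submodule.coe_inner] at this
      refine this.trans ?_
      by_cases hij : i = j
      · simp [hij]
      · have hne : (⟨t, i⟩ : ι) ≠ ⟨t, j⟩ := fun h => 
          hij (sigma_mk_injective (β := fun t : ℝ => Fin (d t)) h)
        rw [if_neg hij, if_neg hne]
    · rw [if_neg fun h' => h (congrArg Sigma.fst h')]
      have := hgsymm (hgraph ⟨t, i⟩) (hgraph ⟨t', j⟩)
      rw [inner_smul_left, inner_smul_right, Complex.conj_ofReal, ← sub_eq_zero, ← sub_mul,
        mul_eq_zero, sub_eq_zero, Complex.ofReal_inj] at this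
      exact this.resolve_left h
  have hsum : ∀ s : Finset ι, ∑ i ∈ s, (i.1)⁻¹ ≤ K := fun s =>
    htrace ι s v (fun i => i.1) horth hvpos hgraph
  -- Each of the values contributes at least `1/R` to a sum bounded by `K`. Nonemptiness of `s`
  -- forces `R > 0`.
  have hcount : ∀ (R : ℝ) (s : Finset ι), s.Nonempty → (∀ i ∈ s, i.1 ≤ R) → s.card ≤ K * R := by
    intro R s ⟨i₀, hi₀⟩ hs
    have hR : 0 < R := (hvpos i₀).trans_le (hs i₀ hi₀)
    have h1 : s.card • R⁻¹ ≤ ∑ i ∈ s, (i.1)⁻¹ :=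
      Finset.card_nsmul_le_sum _ _ _ fun i hi => inv_anti₀ (hvpos i) (hs i hi)
    rw [nsmul_eq_mul] at h1
    exact (mul_inv_le_iff₀ hR).1 (h1.trans (hsum s))
  have hfin : ∀ R : ℝ, {i : ι | i.1 ≤ R}.Finite := by
    intro R
    by_contra hinf
    obtain ⟨N, hN⟩ := exists_nat_gt (K * R)
    obtain ⟨s, hs, hcard⟩ := Set.Infinite.exists_subset_card_eq hinf (N + 1)
    have := hcount R s (Finset.card_pos.1 (by lia)) fun i hi => hs hi
    rw [hcard] at this
    push_cast at this
    linarith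
  have hdpos : ∀ t : ℝ, eigenspace T (t : ℂ) ≠ ⊥ → 0 < d t := fun t ht => by
    have := hfd (t : ℂ)
    exact Nat.pos_of_ne_zero fun h => ht (Submodule.finrank_eq_zero.1 h)
  have hspec : ∀ R : ℝ, {w : ℂ | w ∈ spectrum T ∧ ‖w‖ ≤ R}.Finite := by
    intro R
    refine ((hfin R).image fun i => ((i.1 : ℝ) : ℂ)).subset ?_
    rintro w ⟨hw, hwR⟩
    have hne := eigenspace_ne_bot_of_mem_spectrum hTA hA hw
    obtain ⟨t, ht, rfl⟩ := hpos w hne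
    refine ⟨⟨t, ⟨0, hdpos t hne⟩⟩, ?_, rfl⟩
    simpa [abs_of_pos ht] using hwR
  -- Otherwise the finite-dimensional span `W` of the `v i` would contain every eigenspace of `A`,
  -- the kernel being trivial. By the spectral theorem these have trivial orthogonal complement, so
  -- `W` would be all of `H`.
  have hinf : Infinite ι := by
    by_contra hι
    rw [not_infinite_iff_finite] at hι
    let W := Submodule.span ℂ (Set.range v)
    have hWfd : FiniteDimensional ℂ W := FiniteDimensional.span_of_finite ℂ (Set.finite_range v)
    have hEW : ∀ z : ℂ, eigenspace T z ≤ W := by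
      intro z
      by_cases hne : eigenspace T z = ⊥
      · rw [hne]; exact bot_le
      obtain ⟨t, -, rfl⟩ := hpos z hne
      intro x hx
      have := (stdOrthonormalBasis ℂ (eigenspace T (t : ℂ))).sum_repr ⟨x, hx⟩
      rw [← show ((⟨x, hx⟩ : eigenspace T (t : ℂ)) : H) = x from rfl, ← this, Submodule.coe_sum]
      refine W.sum_mem fun i _ => W.smul_mem _ (Submodule.subset_span ⟨⟨t, i⟩, rfl⟩)
    have hAW : (⨆ μ, Module.End.eigenspace (A : H →ₗ[ℂ] H) μ) ≤ W := by
      refine iSup_le fun μ => ?_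
      by_cases hμ : μ = 0
      · intro x hx
        rw [hμ, Module.End.mem_eigenspace_iff, zero_smul] at hx
        rw [injective_of_mem_graph_iff hTA hx]
        exact W.zero_mem
      · have := eigenspace_eq_inv hTA (inv_ne_zero hμ)
        rw [inv_inv] at this
        rw [← this]
        exact hEW _
    have hW : Wᗮ = ⊥ := by
      rw [← le_bot_iff, ← ContinuousLinearMap.orthogonalComplement_iSup_eigenspaces_eq_bot hA hsymm]
      exact Submodule.orthogonal_le hAW
    rw [Submodule.orthogonal_eq_bot_iff] at hW
    rw [hW] at hWfd
    exact hH (Module.Finite.of_surjective (⊤ : Submodule ℂ H).subtype fun x => ⟨⟨x, trivial⟩, rfl⟩)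
  refine ⟨fun z hz => ⟨?_, eigenspace_ne_bot_of_mem_spectrum hTA hA hz, hfd z⟩, ?_⟩
  · have h1 : ∀ᶠ w in 𝓝[≠] z, ‖w‖ < ‖z‖ + 1 :=
      nhdsWithin_le_nhds (continuous_norm.continuousAt.eventually_lt_const (by simp))
    -- The spectrum in a ball is finite, so removing `z` from it leaves a closed set that misses
    -- `z`.
    have h2 : ∀ᶠ w in 𝓝[≠] z, w ∉ {w : ℂ | w ∈ spectrum T ∧ ‖w‖ ≤ ‖z‖ + 1} \ {z} :=
      nhdsWithin_le_nhds (((hspec (‖z‖ + 1)).subset Set.sdiff_subset).isClosed.isOpen_compl.mem_nhds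
        (by simp))
    filter_upwards [h1, h2, self_mem_nhdsWithin] with w hw1 hw2 hw3 hw
    exact hw2 ⟨⟨hw, hw1.le⟩, hw3⟩
  obtain ⟨e, he⟩ := exists_equiv_nat_monotone_fst d hfin
  refine ⟨fun k => (e k).1, ⟨he, fun z => ?_⟩, fun k => ?_⟩
  · have hrank := Module.finrank_eq_rank ℂ (eigenspace T z)
    rw [← hrank, Cardinal.toENat_nat]
    by_cases hz : ∃ t : ℝ, z = t
    · obtain ⟨t, rfl⟩ := hz
      have hset : {k : ℕ | (((e k).1 : ℝ) : ℂ) = t} =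
          e.symm '' (Set.range fun j : Fin (d t) => (⟨t, j⟩ : ι)) := by
        ext k
        simp only [Set.mem_ofPred_eq, Complex.ofReal_inj]
        constructor
        · rintro rfl
          exact ⟨e k, ⟨(e k).2, rfl⟩, e.symm_apply_apply k⟩
        · rintro ⟨_, ⟨j, rfl⟩, rfl⟩
          rw [e.apply_symm_apply]
      rw [hset, e.symm.injective.encard_image, ← Set.image_univ,
        (sigma_mk_injective (β := fun t : ℝ => Fin (d t)) (i := t)).encard_image, Set.encard_univ]
      simp [d]
    -- For nonreal `z` both multiplicities vanish.
    · have hbot : eigenspace T z = ⊥ := by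
        by_contra hne
        obtain ⟨t, -, h⟩ := hpos z hne
        exact hz ⟨t, h⟩
      rw [hbot, finrank_bot, Nat.cast_zero, Set.encard_eq_zero, Set.eq_empty_iff_forall_notMem]
      exact fun k hk => hz ⟨_, hk.symm⟩
  -- The `k + 1` entries with indices `0, …, k` are all at most the entry with index `k`.
  · have h := hcount (e k).1 ((Finset.range (k + 1)).map e.toEmbedding) (by simp) fun i hi => by
      obtain ⟨j, hj, rfl⟩ := Finset.mem_map.1 hi
      exact he (Nat.lt_succ_iff.1 (Finset.mem_range.1 hj))
    rw [Finset.card_map, Finset.card_range] at h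
    rw [ge_iff_le, div_le_iff₀ hK, mul_comm]
    exact_mod_cast h

end UnboundedOp

/-! ### The space `ℓ²(X, m)`: point evaluations, finite restrictions and tails. -/

namespace VertexMeasure

variable {X : Type*} [MeasurableSpace X] [DiscreteMeasurableSpace X] (m : VertexMeasure X)

/-- A single term of the sum defining the norm. It makes point evaluations continuous. -/
theorem enorm_sq_mul_weight_le (f : X → ℂ) (x : X) :
    ‖f x‖ₑ ^ 2 * m.weight x ≤ eLpNorm f 2 m.toMeasure ^ 2 := by
  have h := eLpNorm_nnreal_pow_eq_lintegral (μ := m.toMeasure) (f := f) (p := 2) two_ne_zero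
  norm_num at h
  rw [h, ← m.toMeasure_singleton, ← lintegral_singleton (fun x => ‖f x‖ₑ ^ 2)]
  exact setLIntegral_le_lintegral _ _

omit [DiscreteMeasurableSpace X] in
theorem enorm_sq_eq_lintegral (f : m.l2) : ‖f‖ₑ ^ 2 = ∫⁻ x, ‖f x‖ₑ ^ 2 ∂m.toMeasure := by
  have h := eLpNorm_nnreal_pow_eq_lintegral (μ := m.toMeasure) (f := f) (p := 2) two_ne_zero
  norm_num at h
  rw [Lp.enorm_def, h]

/-- Pointwise bounds on a set of finite measure bound the norms in `ℓ²(X, m)`. -/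
theorem sum_norm_sq_le (hm : m.toMeasure Set.univ < ∞) {ι : Type*} (s : Finset ι) (g : ι → m.l2)
    (S : Set X) {M : ℝ} (hM : 0 ≤ M) (h : ∀ x ∈ S, ∑ i ∈ s, ‖g i x‖ ^ 2 ≤ M)
    (h0 : ∀ x ∉ S, ∀ i ∈ s, g i x = 0) :
    ∑ i ∈ s, ‖g i‖ ^ 2 ≤ M * m.toMeasure.real S := by
  have hS : m.toMeasure S ≠ ∞ := ((measure_mono (Set.subset_univ S)).trans_lt hm).ne
  have key : ∑ i ∈ s, ‖g i‖ₑ ^ 2 ≤ ENNReal.ofReal M * m.toMeasure S := by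
    simp only [enorm_sq_eq_lintegral]
    rw [← lintegral_finsetSum _ fun i _ => Measurable.of_discrete,
      ← lintegral_indicator_const (MeasurableSet.of_discrete (s := S))]
    refine lintegral_mono fun x => ?_
    by_cases hx : x ∈ S
    · rw [Set.indicator_of_mem hx]
      refine le_trans (le_of_eq ?_) (ENNReal.ofReal_le_ofReal (h x hx))
      rw [ENNReal.ofReal_sum_of_nonneg fun i _ => by positivity]
      refine Finset.sum_congr rfl fun i _ => ?_
      rw [ENNReal.ofReal_pow (norm_nonneg _), ofReal_norm]
    · rw [Set.indicator_of_notMem hx]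
      refine le_of_eq (Finset.sum_eq_zero fun i hi => ?_)
      rw [h0 x hx i hi]
      simp
  have := ENNReal.toReal_mono (ENNReal.mul_ne_top ENNReal.ofReal_ne_top hS) key
  rw [ENNReal.toReal_mul, ENNReal.toReal_ofReal hM,
    ENNReal.toReal_sum fun i _ => ENNReal.pow_ne_top enorm_ne_top] at this
  simpa [Measure.real] using this

theorem norm_apply_sq_mul_weight_le (f : m.l2) (x : X) :
    ‖f x‖ ^ 2 * m.weight x ≤ ‖f‖ ^ 2 := by
  have h := m.enorm_sq_mul_weight_le f x
  rw [← Lp.enorm_def] at h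
  have := ENNReal.toReal_mono (ENNReal.pow_ne_top enorm_ne_top) h
  simpa using this

/-- Evaluation at a vertex. -/
noncomputable def evalCLM (x : X) : m.l2 →L[ℂ] ℂ :=
  LinearMap.mkContinuous
    { toFun := fun f => f x
      map_add' := fun f g => congrFun (m.coe_add f g) x
      map_smul' := fun a f => congrFun (m.coe_smul a f) x } (√(m.weight x : ℝ)⁻¹) fun f => by
    have hx : (0 : ℝ) < m.weight x := m.pos x
    refine le_of_sq_le_sq ?_ (by positivity)
    rw [mul_pow, Real.sq_sqrt (by positivity), inv_mul_eq_div, le_div_iff₀ hx]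
    exact m.norm_apply_sq_mul_weight_le f x

@[simp]
theorem evalCLM_apply (x : X) (f : m.l2) : m.evalCLM x f = f x := rfl

open Classical in
theorem exists_coe_eq_single (x : X) : ∃ e : m.l2, (e : X → ℂ) = Pi.single x 1 := by
  have hfin : m.toMeasure {x} ≠ ∞ := by simp [m.toMeasure_singleton]
  refine ⟨indicatorConstLp 2 (measurableSet_singleton x) hfin (1 : ℂ), ?_⟩
  rw [m.eq_of_ae_eq (indicatorConstLp_coeFn (s := {x}) (hs := measurableSet_singleton x)
    (hμs := hfin) (c := (1 : ℂ)) (p := 2))]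
  funext y
  by_cases hy : y = x <;> simp [hy]

/-- The indicators of points are linearly independent. Infinite dimension is what makes the list of
eigenvalues infinite. -/
theorem not_finiteDimensional [Infinite X] : ¬ FiniteDimensional ℂ m.l2 := by
  classical
  intro hfd
  choose e he using m.exists_coe_eq_single
  have hli : LinearIndependent ℂ e := by
    refine linearIndependent_iff'.2 fun s a hs y hy => ?_
    have := congrArg (m.evalCLM y) hs
    rw [map_zero] at this
    simpa [map_sum, he, Pi.single_apply, hy] using this
  exact not_finite_iff_infinite.2 ‹_› hli.finite

open Classical in
-- Multiplication by the indicator of a finite set has finite rank.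
theorem exists_isCompactOperator_restrict (F : Finset X) : ∃ P : m.l2 →L[ℂ] m.l2,
    IsCompactOperator P ∧ ∀ f x, P f x = if x ∈ F then f x else 0 := by
  choose e he using m.exists_coe_eq_single
  refine ⟨∑ x ∈ F, (m.evalCLM x).smulRight (e x), ?_, fun f x => ?_⟩
  · refine Submodule.sum_mem (compactOperator (RingHom.id ℂ) m.l2 m.l2) fun x _ => ?_
    exact (isCompactOperator_of_locallyCompactSpace_dom (m.evalCLM x)).clm_comp
      (ContinuousLinearMap.toSpanSingleton ℂ (e x))
  · rw [← m.evalCLM_apply, sum_apply, map_sum]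
    simp [he, Pi.single_apply]

/-- The complement of `F` carries a tail of the convergent sum of weights. -/
theorem exists_finset_measure_compl_le (hm : m.toMeasure Set.univ < ∞) {ε : ℝ} (hε : 0 < ε) :
    ∃ F : Finset X, m.toMeasure.real (F : Set X)ᶜ ≤ ε := by
  have hS : ∀ S : Set X, m.toMeasure S = ∑' x : S, (m.weight x : ℝ≥0∞) := fun S => by
    classical
    rw [toMeasure, Measure.sum_apply _ MeasurableSet.of_discrete,
      tsum_subtype S fun x => (m.weight x : ℝ≥0∞)]
    refine tsum_congr fun x => ?_
    by_cases hx : x ∈ S <;> simp [hx]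
  have htot : ∑' x, (m.weight x : ℝ≥0∞) ≠ ∞ := by
    rw [hS, tsum_univ fun x => (m.weight x : ℝ≥0∞)] at hm
    exact hm.ne
  obtain ⟨F, hF⟩ := ((ENNReal.tendsto_tsum_compl_atTop_zero htot).eventually_lt_const
    (ENNReal.ofReal_pos.2 hε)).exists
  refine ⟨F, ENNReal.toReal_le_of_le_ofReal hε.le ?_⟩
  rw [hS]
  exact hF.le

end VertexMeasure

/-! ### The Dirichlet form under uniform transience. -/

namespace WeightedGraph

variable {X : Type*} {G : WeightedGraph X}

theorem conj_energyForm (f g : X → ℂ) : conj (G.energyForm f g) = G.energyForm g f := by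
  unfold energyForm
  rw [map_add, map_mul, Complex.conj_tsum, Complex.conj_tsum]
  congr 2
  · rw [map_inv₀, Complex.conj_ofNat]
  · refine tsum_congr fun p => ?_
    simp only [map_mul, map_sub, Complex.conj_conj, Complex.conj_ofReal]
    ring
  · funext x
    simp only [map_mul, Complex.conj_conj, Complex.conj_ofReal]
    ring

/-- The energy is lower semicontinuous under pointwise convergence. -/
theorem energy_le_of_tendsto {u : ℕ → X → ℂ} {f : X → ℂ} {B : ℝ≥0∞}
    (hu : ∀ x, Tendsto (fun n => u n x) atTop (𝓝 (f x)))
    (hB : ∀ᶠ n in atTop, G.energy (u n) ≤ B) : G.energy f ≤ B := by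
  -- Fatou: each term is continuous for pointwise convergence, and sums of nonnegative lower
  -- semicontinuous functions are lower semicontinuous.
  have hlsc : LowerSemicontinuous G.energy := by
    unfold energy
    have h1 : ∀ p : X × X, LowerSemicontinuous fun f : X → ℂ =>
        2⁻¹ * ((G.b p.1 p.2 : ℝ≥0∞) * ‖f p.1 - f p.2‖ₑ ^ 2) := fun p => by
      refine Continuous.lowerSemicontinuous ?_
      refine ENNReal.continuous_const_mul (by simp) |>.comp
        (ENNReal.continuous_const_mul (by simp) |>.comp ?_)
      fun_prop
    have h2 : ∀ x : X, LowerSemicontinuous fun f : X → ℂ =>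
        (G.c x : ℝ≥0∞) * ‖f x‖ₑ ^ 2 := fun x => by
      refine Continuous.lowerSemicontinuous (ENNReal.continuous_const_mul (by simp) |>.comp ?_)
      fun_prop
    simp only [← ENNReal.tsum_mul_left]
    exact (lowerSemicontinuous_tsum h1).add (lowerSemicontinuous_tsum h2)
  by_contra! h
  have := (tendsto_pi_nhds.2 hu).eventually (hlsc f B h)
  obtain ⟨n, h1, h2⟩ := (this.and hB).exists
  exact absurd h1 (not_lt.2 h2)

variable [MeasurableSpace X] [DiscreteMeasurableSpace X] {m : VertexMeasure X}

/-- Since `|g(o)|² ≤ ‖g‖² / m(o)`, the norm defining `D̃₀` is dominated by the form norm, with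
factor `1 + 1/m(o)` on squares. The same finitely supported approximants therefore serve both
closures. -/
theorem mem_finiteEnergyClosure_of_mem_dirichletDomain {f : m.l2} (hf : f ∈ G.dirichletDomain m)
    (o : X) : (f : X → ℂ) ∈ G.finiteEnergyClosure o := by
  refine ⟨hf.1, fun ε hε => ?_⟩
  have hm0 : (m.weight o : ℝ≥0∞) ≠ 0 := by exact_mod_cast (m.pos o).ne'
  have hw0 : 1 + (m.weight o : ℝ≥0∞)⁻¹ ≠ 0 := by simp
  have hw1 : 1 + (m.weight o : ℝ≥0∞)⁻¹ ≠ ∞ := by simpa using (m.pos o).ne'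
  obtain ⟨φ, hφ, h⟩ := hf.2 (ε / (1 + (m.weight o : ℝ≥0∞)⁻¹)) (ENNReal.div_pos hε.ne' hw1)
  refine ⟨φ, hφ, lt_of_le_of_lt ?_ ((ENNReal.lt_div_iff_mul_lt (Or.inl hw0) (Or.inl hw1)).1 h)⟩
  rw [mul_add, mul_one]
  refine add_le_add le_self_add ?_
  rw [← div_eq_mul_inv, ENNReal.le_div_iff_mul_le (Or.inl hm0) (Or.inl (by simp))]
  exact (m.enorm_sq_mul_weight_le (f - φ) o).trans le_add_self

/-- The only point at which the inequality of uniform transience enters; all later estimates rest on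
this pointwise bound. -/
theorem norm_apply_sq_le {C : ℝ} (hC : G.IsUniformlyTransientWith C) {f : m.l2}
    (hf : f ∈ G.dirichletDomain m) (x : X) : ‖f x‖ ^ 2 ≤ C * (G.energy f).toReal := by
  have h := hC.2.2 x f (mem_finiteEnergyClosure_of_mem_dirichletDomain hf x)
  have h1 : ‖f x‖ₑ ^ 2 ≤ ENNReal.ofReal C * G.energy f :=
    (pow_le_pow_left₀ (zero_le) (le_iSup (fun x => ‖f x‖ₑ) x) 2).trans h
  have := ENNReal.toReal_mono (ENNReal.mul_ne_top ENNReal.ofReal_ne_top hf.1.ne) h1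
  simpa [ENNReal.toReal_ofReal hC.2.1.le] using this

theorem re_dirichletForm_self (f : G.dirichletDomain m) :
    (G.dirichletForm m f f).re = (G.energy (f : m.l2)).toReal := by
  change (G.energyForm _ _).re = _
  rw [energyForm_self f.2.1, Complex.ofReal_re]

/-- Poincaré inequality on the domain of the Dirichlet form. -/
theorem norm_sq_le_dirichletForm (hm : m.toMeasure Set.univ < ∞) {C : ℝ}
    (hC : G.IsUniformlyTransientWith C) (f : G.dirichletDomain m) :
    ‖(f : m.l2)‖ ^ 2 ≤ C * m.toMeasure.real Set.univ * (G.dirichletForm m f f).re := by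
  have := m.sum_norm_sq_le hm {()} (fun _ => (f : m.l2)) Set.univ
    (M := C * (G.energy (f : m.l2)).toReal) (mul_nonneg hC.2.1.le ENNReal.toReal_nonneg)
    (fun x _ => by simpa using norm_apply_sq_le hC f.2 x) (by simp)
  rw [Finset.sum_singleton] at this
  rw [re_dirichletForm_self]
  linarith

/-- Take `P` to be restriction to a finite `F` with `m(X \ F) ≤ ε / C`; off `F` the pointwise bound
`C Q(f)` is integrated. -/
theorem exists_isCompactOperator_norm_sub_sq_le (hm : m.toMeasure Set.univ < ∞) {C : ℝ}
    (hC : G.IsUniformlyTransientWith C) {ε : ℝ} (hε : 0 < ε) :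
    ∃ P : m.l2 →L[ℂ] m.l2, IsCompactOperator P ∧
      ∀ f : G.dirichletDomain m, ‖(f : m.l2) - P f‖ ^ 2 ≤ ε * (G.dirichletForm m f f).re := by
  classical
  have hC0 := hC.2.1
  obtain ⟨F, hF⟩ := m.exists_finset_measure_compl_le hm (div_pos hε hC0)
  obtain ⟨P, hP, hPf⟩ := m.exists_isCompactOperator_restrict F
  refine ⟨P, hP, fun f => ?_⟩
  have hsub : ∀ x, ((f : m.l2) - P f) x = if x ∈ F then 0 else (f : m.l2) x := fun x => by
    rw [← m.evalCLM_apply, map_sub, m.evalCLM_apply, m.evalCLM_apply, hPf]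
    split_ifs <;> simp
  have hE : 0 ≤ (G.energy (f : m.l2)).toReal := ENNReal.toReal_nonneg
  have := m.sum_norm_sq_le hm {()} (fun _ => (f : m.l2) - P f) (F : Set X)ᶜ
    (M := C * (G.energy (f : m.l2)).toReal) (by positivity)
    (fun x hx => by
      rw [Finset.sum_singleton, hsub, if_neg fun h => hx (Finset.mem_coe.2 h)]
      exact norm_apply_sq_le hC f.2 x)
    (fun x hx _ _ => by rw [hsub, if_pos (by simpa using hx)])
  rw [Finset.sum_singleton] at this
  rw [re_dirichletForm_self]
  calc _ ≤ _ := this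
    _ ≤ C * (G.energy (f : m.l2)).toReal * (ε / C) := by gcongr
    _ = _ := by field_simp

/-- The Dirichlet form is closed. -/
theorem dirichletForm_complete (hm : m.toMeasure Set.univ < ∞) {C : ℝ}
    (hC : G.IsUniformlyTransientWith C) (u : ℕ → G.dirichletDomain m)
    (hu : ∀ ε > 0, ∃ N, ∀ k ≥ N, ∀ n ≥ N, (G.dirichletForm m (u k - u n) (u k - u n)).re < ε) :
    ∃ v, ∀ ε > 0, ∃ N, ∀ n ≥ N, (G.dirichletForm m (u n - v) (u n - v)).re < ε := by
  set K := C * m.toMeasure.real Set.univ with hKdef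
  have hK : 0 ≤ K := mul_nonneg hC.2.1.le measureReal_nonneg
  -- By the Poincaré inequality form-Cauchy sequences are Cauchy in `ℓ²`, so a limit exists in `ℓ²`
  -- and hence pointwise.
  have hcauchy : CauchySeq fun n => (u n : m.l2) := by
    refine Metric.cauchySeq_iff.2 fun ε hε => ?_
    obtain ⟨N, hN⟩ := hu (ε ^ 2 / (K + 1)) (by positivity)
    refine ⟨N, fun k hk n hn => ?_⟩
    have h1 := norm_sq_le_dirichletForm hm hC (u k - u n)
    rw [← hKdef] at h1
    have h2 := hN k hk n hn
    rw [lt_div_iff₀ (by positivity)] at h2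
    have h3 : 0 ≤ (G.dirichletForm m (u k - u n) (u k - u n)).re := by
      rw [re_dirichletForm_self]; exact ENNReal.toReal_nonneg
    rw [dist_eq_norm, ← pow_lt_pow_iff_left₀ (norm_nonneg _) hε.le two_ne_zero]
    change ‖((u k - u n : G.dirichletDomain m) : m.l2)‖ ^ 2 < _
    nlinarith
  obtain ⟨f, hf⟩ := cauchySeq_tendsto_of_complete hcauchy
  have hpt : ∀ x, Tendsto (fun n => (u n : m.l2) x) atTop (𝓝 (f x)) := fun x =>
    ((m.evalCLM x).continuous.tendsto f).comp hf
  have hcoe : ∀ g h : m.l2, ((g - h : m.l2) : X → ℂ) = (g : X → ℂ) - h := fun g h =>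
    m.eq_of_ae_eq (Lp.coeFn_sub g h)
  -- Fix `n` and let `k → ∞` in `Q(u k - u n) < ε`, using lower semicontinuity.
  have hlim : ∀ ε > 0, ∃ N, ∀ n ≥ N,
      G.energy (f - u n : m.l2) ≤ ENNReal.ofReal ε := by
    intro ε hε
    obtain ⟨N, hN⟩ := hu ε hε
    refine ⟨N, fun n hn => ?_⟩
    refine energy_le_of_tendsto (u := fun k => (((u k : m.l2) - u n : m.l2) : X → ℂ))
      (fun x => ?_) ?_
    · simp only [hcoe]
      exact (hpt x).sub tendsto_const_nhds
    · filter_upwards [eventually_ge_atTop N] with k hk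
      have := hN k hk n hn
      rw [re_dirichletForm_self] at this
      exact (ENNReal.le_ofReal_iff_toReal_le (u k - u n).2.1.ne hε.le).2 this.le
  have hform : Tendsto (fun n => G.formNormSq m ((f : X → ℂ) - (u n : m.l2))) atTop (𝓝 0) := by
    have h1 : Tendsto (fun n => G.energy ((f : X → ℂ) - (u n : m.l2))) atTop (𝓝 0) := by
      refine ENNReal.tendsto_atTop_zero.2 fun ε hε => ?_
      obtain ⟨r, hr, hrε⟩ := ENNReal.lt_iff_exists_nnreal_btwn.1 hε
      obtain ⟨N, hN⟩ := hlim r (by exact_mod_cast hr)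
      refine ⟨N, fun n hn => ?_⟩
      rw [← hcoe]
      exact (hN n hn).trans (by rw [ENNReal.ofReal_coe_nnreal]; exact hrε.le)
    have h2 : Tendsto (fun n => eLpNorm ((f : X → ℂ) - ((u n : m.l2) : X → ℂ)) 2 m.toMeasure ^ 2)
        atTop (𝓝 0) := by
      have h := ((ENNReal.continuous_pow 2).tendsto _).comp
        (((tendsto_const_nhds (x := f)).sub hf).enorm)
      rw [sub_self, enorm_zero, zero_pow two_ne_zero] at h
      simpa only [Function.comp_def, Lp.enorm_def, hcoe] using h
    simpa [formNormSq] using h1.add h2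
  have hfmem : f ∈ G.dirichletDomain m := by
    refine ⟨?_, fun ε hε => ?_⟩
    · obtain ⟨N, hN⟩ := hlim 1 one_pos
      have h1 := energy_add_le (G := G) ((u N : m.l2) : X → ℂ) ((f - u N : m.l2) : X → ℂ)
      rw [← m.coe_add, add_sub_cancel] at h1
      exact h1.trans_lt (ENNReal.mul_lt_top (by simp) (ENNReal.add_lt_top.2
        ⟨(u N).2.1, (hN N le_rfl).trans_lt ENNReal.ofReal_lt_top⟩))
    -- A diagonal argument: approximate `f` by some `u n`, and `u n` by a finitely supported `φ`.
    -- The quarter absorbs the factor 2 in `formNormSq_add_le`.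
    · have hε' : 0 < ε / 2 / 2 := ENNReal.half_pos (ENNReal.half_pos hε.ne').ne'
      obtain ⟨n, hn⟩ := (hform.eventually_lt_const hε').exists
      obtain ⟨φ, hφ, h⟩ := (u n).2.2 _ hε'
      refine ⟨φ, hφ, ?_⟩
      rw [← sub_add_sub_cancel (f : X → ℂ) ((u n : m.l2) : X → ℂ) φ]
      refine (formNormSq_add_le _ _).trans_lt ?_
      rw [mul_comm]
      exact (ENNReal.lt_div_iff_mul_lt (by simp) (by simp)).1
        ((ENNReal.add_lt_add hn h).trans_le (ENNReal.add_halves _).le)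
  refine ⟨⟨f, hfmem⟩, fun ε hε => ?_⟩
  obtain ⟨N, hN⟩ := hlim (ε / 2) (half_pos hε)
  refine ⟨N, fun n hn => ?_⟩
  rw [← neg_sub, map_neg (G.dirichletForm m _), map_neg, LinearMap.neg_apply, neg_neg,
    re_dirichletForm_self]
  exact (ENNReal.toReal_le_of_le_ofReal (half_pos hε).le (hN n hn)).trans_lt (half_lt_self hε)

theorem graph_dirichletLaplacian :
    (G.dirichletLaplacian m).graph =
      UnboundedOp.formGraph (G.dirichletDomain m) (G.dirichletForm m) :=
  UnboundedOp.graph_formGenerator (dense_dirichletDomain G m) _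

/-- The sum of the reciprocals of the eigenvalues along an orthonormal family of eigenvectors is
at most `C m(X)`. -/
theorem sum_inv_eigenvalue_le (hm : m.toMeasure Set.univ < ∞) {C : ℝ}
    (hC : G.IsUniformlyTransientWith C) {ι : Type*} (s : Finset ι) (v : ι → m.l2) (t : ι → ℝ)
    (hv : Orthonormal ℂ v) (ht : ∀ i, 0 < t i)
    (hgraph : ∀ i, (v i, (t i : ℂ) • v i) ∈ (G.dirichletLaplacian m).graph) :
    ∑ i ∈ s, (t i)⁻¹ ≤ C * m.toMeasure.real Set.univ := by
  classical
  -- The pointwise bound for `f = ∑ a i • v i`; orthonormality diagonalizes the form to `Q(f) = ∑ |a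
  -- i|² t i`.
  have hpt : ∀ (a : ι → ℂ) (x : X),
      ‖∑ i ∈ s, a i * v i x‖ ^ 2 ≤ C * ∑ i ∈ s, ‖a i‖ ^ 2 * t i := by
    intro a x
    have hmem : (∑ i ∈ s, a i • v i, ∑ i ∈ s, a i • (t i : ℂ) • v i) ∈
        (G.dirichletLaplacian m).graph := by
      have := (G.dirichletLaplacian m).graph.sum_mem (t := s)
        fun i _ => (G.dirichletLaplacian m).graph.smul_mem (a i) (hgraph i)
      simpa [Prod.ext_iff, Prod.fst_sum, Prod.snd_sum, prod_mk_sum] using this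
    rw [graph_dirichletLaplacian] at hmem
    obtain ⟨h1, h2⟩ := hmem
    have h3 := h2 ⟨_, h1⟩
    have h4 := norm_apply_sq_le hC h1 x
    have h5 := re_dirichletForm_self (G := G) ⟨_, h1⟩
    simp only at h3 h4 h5
    rw [← h5, h3, ← m.evalCLM_apply, map_sum] at h4
    have h6 : inner ℂ (∑ i ∈ s, a i • v i) (∑ i ∈ s, a i • (t i : ℂ) • v i) =
        ((∑ i ∈ s, ‖a i‖ ^ 2 * t i : ℝ) : ℂ) := by
      simp only [smul_smul]
      rw [hv.inner_sum]
      push_cast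
      refine Finset.sum_congr rfl fun i _ => ?_
      rw [← mul_assoc, ← Complex.normSq_eq_conj_mul_self, Complex.normSq_eq_norm_sq]
      push_cast
      rfl
    rw [h6, Complex.ofReal_re] at h4
    simpa using h4
  have hsum : ∀ x, ∑ i ∈ s, ‖v i x‖ ^ 2 / t i ≤ C := by
    intro x
    set S := ∑ i ∈ s, ‖v i x‖ ^ 2 / t i with hS
    have hS0 : 0 ≤ S := Finset.sum_nonneg fun i _ => div_nonneg (sq_nonneg _) (ht i).le
    -- The extremal coefficients in Cauchy–Schwarz, a truncated Green function with pole at `x`.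
    -- Both `f(x)` and `Q(f)` equal `S`, so the bound reads `S² ≤ C S`.
    have h := hpt (fun i => conj (v i x) / t i) x
    have h1 : ∑ i ∈ s, conj (v i x) / (t i : ℂ) * v i x = ((S : ℝ) : ℂ) := by
      rw [hS]
      push_cast
      refine Finset.sum_congr rfl fun i _ => ?_
      rw [div_mul_eq_mul_div, ← Complex.normSq_eq_conj_mul_self, Complex.normSq_eq_norm_sq]
      push_cast
      rfl
    have h2 : ∑ i ∈ s, ‖conj (v i x) / (t i : ℂ)‖ ^ 2 * t i = S := by
      refine Finset.sum_congr rfl fun i _ => ?_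
      have := (ht i).ne'
      rw [norm_div, RCLike.norm_conj, Complex.norm_real, Real.norm_of_nonneg (ht i).le]
      field_simp
    rw [h1, h2, Complex.norm_real, Real.norm_of_nonneg hS0] at h
    rcases hS0.eq_or_lt with h0 | h0
    · rw [← h0]; exact hC.2.1.le
    · nlinarith
  have hsqrt : ∀ i, ‖((√(t i))⁻¹ : ℂ)‖ ^ 2 = (t i)⁻¹ := fun i => by
    rw [norm_inv, Complex.norm_real, Real.norm_of_nonneg (Real.sqrt_nonneg _), inv_pow,
      Real.sq_sqrt (ht i).le]
  -- Rescaling each `v i` by `(t i)^{-1/2}` turns the bound of `hsum` into one on a sum of squared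
  -- norms, here integrated over all of `X`.
  have := m.sum_norm_sq_le hm s (fun i => ((√(t i))⁻¹ : ℂ) • v i) Set.univ hC.2.1.le
    (fun x _ => by
      refine le_trans (le_of_eq (Finset.sum_congr rfl fun i _ => ?_)) (hsum x)
      rw [m.coe_smul, Pi.smul_apply, norm_smul, mul_pow, hsqrt, inv_mul_eq_div]) (by simp)
  refine le_trans (le_of_eq (Finset.sum_congr rfl fun i _ => ?_)) this
  rw [norm_smul, mul_pow, hsqrt, hv.1 i, one_pow, mul_one]

end WeightedGraph

/-! ### The main theorem; `ev k` is `λ_{k+1}`, whence the numerator `k + 1`. -/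

open WeightedGraph in
theorem mainTheorem7 {X : Type*} [Countable X] [Infinite X]
    [MeasurableSpace X] [DiscreteMeasurableSpace X]
    (G : WeightedGraph X) (m : VertexMeasure X) (hm : m.toMeasure Set.univ < ∞)
    (C : ℝ) (hC : G.IsUniformlyTransientWith C) :
    UnboundedOp.HasPurelyDiscreteSpectrum (G.dirichletLaplacian m) ∧
      ∃ ev : ℕ → ℝ, UnboundedOp.IsEigenvalueSequence (G.dirichletLaplacian m) ev ∧
        ∀ k : ℕ, ev k ≥ (k + 1 : ℝ) / (C * m.toMeasure.real Set.univ) := by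
  have hsymm : ∀ f g, conj (G.dirichletForm m f g) = G.dirichletForm m g f := fun f g =>
    conj_energyForm _ _
  have hm0 : 0 < m.toMeasure.real Set.univ := by
    obtain ⟨x⟩ : Nonempty X := inferInstance
    refine ENNReal.toReal_pos (fun h => ?_) hm.ne
    have := measure_mono_null (Set.subset_univ {x}) h
    rw [m.toMeasure_singleton] at this
    exact (m.pos x).ne' (by exact_mod_cast this)
  have hK : 0 < C * m.toMeasure.real Set.univ := mul_pos hC.2.1 hm0
  have hcoer := norm_sq_le_dirichletForm hm hC
  obtain ⟨A, hAsymm, hA⟩ := UnboundedOp.exists_solutionOperator (G.dirichletDomain m)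
    (G.dirichletForm m) hsymm _ hK.le hcoer (dirichletForm_complete hm hC)
    fun f => by rw [re_dirichletForm_self]; exact ENNReal.toReal_nonneg
  refine UnboundedOp.hasPurelyDiscreteSpectrum_and_exists_eigenvalueSequence
    m.not_finiteDimensional (A := A) (fun f g => by rw [graph_dirichletLaplacian, hA])
    (UnboundedOp.isCompactOperator_solutionOperator _ _ hA fun ε hε =>
      exists_isCompactOperator_norm_sub_sq_le hm hC hε) hAsymm hK
    (fun z hz => UnboundedOp.exists_pos_eq_of_eigenspace_ne_bot _ (dense_dirichletDomain G m) _
      hsymm _ hK.le hcoer hz)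
    fun ι s v t hv ht h => sum_inv_eigenvalue_le hm hC s v t hv ht h
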